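/- A weighted graph is a finite simple graph $G$ with a weight function $w:V(G)\to[0,\infty)$; it is even if $|V(G)|$ is even. In the game on a connected weighted graph $G$, two players alternately claim a vertex of the remaining graph until all vertices have been claimed, and a player's score is the total weight of the vertices that this player has claimed, which each player wants to maximize. A vertex $v$ may be claimed only if deleting it leaves the remaining graph connected (or empty). For a set $S\subseteq V(G)$ meeting every component of $G$, the game on $G$ rooted at $S$ is the same except that $v$ may be claimed if and only if, after deleting $v$, every component of the remaining graph contains a vertex of $S$. For $k\in\{1,2\}$ let $N(G,k)$ and $R(G,S,k)$ denote the scores of Player $k$ in the game on $G$ and in the game on $G$ rooted at $S$, respectively, when both players play optimally (Player $1$ moves first); write $R(G,v,k)=R(G,\{v\},k)$. A blow-up of a graph $T$ with vertices $v_1,\dots,v_k$ is a graph obtained by replacing $v_1,\dots,v_k$ with non-empty disjoint sets $V_1,\dots,V_k$, where $x\in V_i$ and $y\in V_j$ are adjacent if and only if $v_i$ and $v_j$ are adjacent in $T$. For a graph $H$, an $H$-tree is a graph obtained from $H$ and trees $T_a$ $(a\in V(H))$ by identifying each vertex $a$ of $H$ with exactly one vertex of $T_a$. For $X\subseteq V(H)$,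 $N_H(X)$ is the set of vertices of $H$ having a neighbour in $X$. **Lemma 4.** Let $H$ be a blow-up of a tree, with vertex classes $V_1,\dots,V_k$, and let $G$ be an even connected weighted $H$-tree. Then: 1. for every $v\in V(G)$, $R(G,v,1)\ge N(G,2)$ and (equivalently) $R(G,v,2)\le N(G,1)$; 2. for every $i\in[k]$, $R(G,V_i,1)\ge N(G,2)$ and (equivalently) $R(G,V_i,2)\le N(G,1)$; 3. for every $i\in[k]$ with $N_H(V_i)\neq\emptyset$ (that is, for every $i$ if $k\ge2$), $R(G,N_H(V_i),1)\ge N(G,2)$ and (equivalently) $R(G,N_H(V_i),2)\le N(G,1)$. -/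

import Mathlib

open scoped NNReal

noncomputable section

namespace GraphGrabbing

/-! ### Blow-ups and graphs obtained by attaching trees -/

/-- `H` is the blow-up of `T` in which the vertex `i` of `T` is replaced with the set
`V_i = part ⁻¹' {i}`: these sets are non-empty, and `x ∈ V_i`, `y ∈ V_j` are adjacent in `H` if and
only if `i` and `j` are adjacent in `T`. -/
structure IsBlowUp {ι W : Type*} (T : SimpleGraph ι) (H : SimpleGraph W) (part : W → ι) :
    Prop where
  nonempty : ∀ i, (part ⁻¹' {i}).Nonempty
  adj_iff : ∀ x y, H.Adj x y ↔ T.Adj (part x) (part y)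

/-- `G` is an `H`-tree: it is obtained from `H` and trees `T_a` (one for every vertex `a` of `H`) by
identifying every vertex `a` of `H` with exactly one vertex of `T_a`.
Here `base x` is the `a` for which `x` is a vertex of `T_a`, so that `T_a` is the subgraph of `G`
induced by `{x | base x = a}`, and `hub a` is the vertex of `T_a` identified with `a`. -/
structure IsHTree {W V : Type*} (H : SimpleGraph W) (G : SimpleGraph V)
    (hub : W → V) (base : V → W) : Prop where
  base_hub : ∀ a, base (hub a) = a
  isTree : ∀ a, (G.induce {x | base x = a}).IsTree
  adj_iff : ∀ x y, base x ≠ base y →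
    (G.Adj x y ↔ x = hub (base x) ∧ y = hub (base y) ∧ H.Adj (base x) (base y))

/-- The neighbourhood of a set: all vertices having a neighbour in `S`. -/
def nbhd {W : Type*} (H : SimpleGraph W) (S : Set W) : Set W :=
  {y | ∃ x ∈ S, H.Adj y x}

/-! ### The games -/

/-- The two players; `one` moves first. -/
inductive Player
  | one
  | two

/-- The scores (of the player to move, of the other player) under optimal play, when `U` is the set
of vertices that have not been claimed yet, `feasible U v` says that `v ∈ U` may be claimed, and
`w v` is the weight of `v`. After `v` has been claimed the players change roles. The player to move
maximizes the own score; the sum of both scores being constant, this also minimizes the score of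
the other player. When all vertices have been claimed, both scores are `0`. -/
def score {V : Type*} [DecidableEq V] (feasible : Finset V → V → Prop) (w : V → ℝ≥0)
    (U : Finset V) : ℝ≥0 × ℝ≥0 :=
  (⨆ v : {v : V // v ∈ U ∧ feasible U v}, w v.1 + (score feasible w (U.erase v.1)).2,
   ⨅ v : {v : V // v ∈ U ∧ feasible U v}, (score feasible w (U.erase v.1)).1)
termination_by U.card
decreasing_by all_goals exact Finset.card_erase_lt_of_mem v.2.1

/-- In the unrooted game `v` is feasible if the remaining graph without `v` is connected
(the graph without vertices counts as connected, so that the last vertex can be claimed). -/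
def feasibleN {V : Type*} [DecidableEq V] (G : SimpleGraph V) (U : Finset V) (v : V) : Prop :=
  (G.induce (U.erase v : Set V)).Preconnected

/-- In the game rooted at `S`, `v` is feasible if every component of the remaining graph without `v`
contains at least one vertex of `S`. -/
def feasibleR {V : Type*} [DecidableEq V] (G : SimpleGraph V) (S : Set V) (U : Finset V) (v : V) :
    Prop :=
  ∀ C : (G.induce (U.erase v : Set V)).ConnectedComponent, ∃ s ∈ C.supp, (s : V) ∈ S

/-- The score of a player in the game on `G` when both players play optimally. -/
def N {V : Type*} [Fintype V] [DecidableEq V] (G : SimpleGraph V) (w : V → ℝ≥0) : Player → ℝ≥0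
  | .one => (score (feasibleN G) w Finset.univ).1
  | .two => (score (feasibleN G) w Finset.univ).2

/-- The score of a player in the game on `G` rooted at `S` when both players play optimally. -/
def R {V : Type*} [Fintype V] [DecidableEq V] (G : SimpleGraph V) (w : V → ℝ≥0) (S : Set V) :
    Player → ℝ≥0
  | .one => (score (feasibleR G S) w Finset.univ).1
  | .two => (score (feasibleR G S) w Finset.univ).2

end GraphGrabbing

end

/-! Write c and r for the mover's score minus the opponent's score in the unrooted and in the rooted
game. Both scores in a game add up to the total weight, so each of the claimed inequalities says 0 ≤
c + r on the even vertex set.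

Suppose that the vertices split into B and C, with the edges between them forming a complete
bipartite graph between P ⊆ B and Q ⊆ C. A move in the game rooted at P is then a move in one of two
smaller games, B rooted at P and C rooted at Q, except that B must not run out before C. A player
who always answers in the part just played obtains bounds for the game on B ∪ C
(`IsSplit.rootedVal_union_le`). Opening with an optimal move in a suitable part gives lower bounds
for the values of the games rooted at P and at Q. For an even number of vertices these bounds are
negatives of each other, so the two values have a nonnegative sum (`IsSplit.rootedVal_add_nonneg`).

To get from the second rooted game to the unrooted one, an induction on the number of vertices
proves two statements together: c ≤ r for odd sets and 0 ≤ c + r for even sets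
(`IsRootFamily.comparison`). In the even case the set Q is chosen so that moves rooted at Q keep the
graph connected. The odd statement one level below then bounds the value rooted at Q by c. In the
odd case one optimal unrooted move is played; what can go wrong is that the claimed vertex is the
only root, or that the reply disconnects the graph. In both situations the roots left over are the
remaining neighbours of a single vertex, and the game rooted at that vertex, where it is claimed
last, settles the matter.

The induction needs only a family of root sets with suitable splits (`IsRootFamily`). For an
`H`-tree this family consists of single vertices, classes and neighbourhoods of classes; acyclicity
of `T` and of the attached trees makes it closed under the required operations, also on connected
subsets (`IsHTree.isRootFamily`). -/

namespace GraphGrabbing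

/-! ### Connected and rooted vertex sets -/

/-- `A` is a union of components of the subgraph of `G` induced by `X`. -/
structure ClosedIn {V : Type*} (G : SimpleGraph V) (X A : Set V) : Prop where
  subset : A ⊆ X
  mem_of_adj : ∀ a ∈ A, ∀ b ∈ X, G.Adj a b → b ∈ A

/-- Every non-empty union of components of `G[X]` is `X`. -/
def Conn {V : Type*} (G : SimpleGraph V) (X : Set V) : Prop :=
  ∀ A, ClosedIn G X A → A.Nonempty → A = X

/-- Every component of `G[X]` meets `S`. -/
def Rooted {V : Type*} (G : SimpleGraph V) (S X : Set V) : Prop :=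
  ∀ A, ClosedIn G X A → A.Nonempty → (A ∩ S).Nonempty

section Connectivity

variable {V : Type*} {G : SimpleGraph V} {X A S : Set V}

theorem ClosedIn.mem_of_reachable (hA : ClosedIn G X A) {a b : X}
    (h : (G.induce X).Reachable a b) (ha : (a : V) ∈ A) : (b : V) ∈ A := by
  obtain ⟨p⟩ := h
  induction p with
  | nil => exact ha
  | cons hadj _ ih => exact ih (hA.mem_of_adj _ ha _ (Subtype.coe_prop _) hadj)

theorem closedIn_reachable (a : X) :
    ClosedIn G X {b | ∃ h : b ∈ X, (G.induce X).Reachable a ⟨b, h⟩} where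
  subset := fun _ hb => hb.1
  mem_of_adj := by
    rintro b ⟨hb, hab⟩ c hc hbc
    exact ⟨hc, hab.trans (SimpleGraph.Adj.reachable (by exact hbc))⟩

theorem ClosedIn.refl : ClosedIn G X X := ⟨subset_rfl, fun _ _ _ hb _ => hb⟩

theorem ClosedIn.diff (hA : ClosedIn G X A) : ClosedIn G X (X \ A) :=
  ⟨Set.sdiff_subset, fun a ha b hb hab => ⟨hb, fun h => ha.2 (hA.mem_of_adj b h a ha.1 hab.symm)⟩⟩

theorem preconnected_induce_iff : (G.induce X).Preconnected ↔ Conn G X := by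
  constructor
  · rintro h A hA ⟨a, ha⟩
    refine hA.subset.antisymm fun b hb => ?_
    exact hA.mem_of_reachable (h ⟨a, hA.subset ha⟩ ⟨b, hb⟩) ha
  · intro h a b
    have := h _ (closedIn_reachable a) ⟨a, a.2, SimpleGraph.Reachable.refl _⟩
    exact (this.superset b.2).2

theorem forall_component_iff :
    (∀ C : (G.induce X).ConnectedComponent, ∃ s ∈ C.supp, (s : V) ∈ S) ↔ Rooted G S X := by
  constructor
  · rintro h A hA ⟨a, ha⟩
    obtain ⟨s, hs, hsS⟩ := h ((G.induce X).connectedComponentMk ⟨a, hA.subset ha⟩)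
    have hs' : (G.induce X).Reachable ⟨a, hA.subset ha⟩ s :=
      (SimpleGraph.ConnectedComponent.exact hs).symm
    exact ⟨s, hA.mem_of_reachable hs' ha, hsS⟩
  · intro h C
    induction C using SimpleGraph.ConnectedComponent.ind with
    | h a =>
      obtain ⟨s, ⟨hs, has⟩, hsS⟩ :=
        h _ (closedIn_reachable a) ⟨a, a.2, SimpleGraph.Reachable.refl _⟩
      exact ⟨⟨s, hs⟩, SimpleGraph.ConnectedComponent.sound has.symm, hsS⟩

theorem rooted_empty : Rooted G S ∅ := fun _ hA h => (h.mono hA.subset).mono (by simp)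

theorem Conn.rooted (h : Conn G X) (hS : (X ∩ S).Nonempty) : Rooted G S X := by
  intro A hA hne
  rwa [h A hA hne]

theorem Rooted.nonempty (h : Rooted G S X) (hX : X.Nonempty) : (X ∩ S).Nonempty :=
  h X .refl hX

theorem Rooted.conn {r : V} (h : Rooted G {r} X) : Conn G X := by
  intro A hA hne
  obtain ⟨a, ha, rfl⟩ := h A hA hne
  by_contra hAX
  obtain ⟨b, hb, hb'⟩ := h _ hA.diff (Set.sdiff_nonempty.2 fun hXA => hAX (hA.subset.antisymm hXA))
  exact hb.2 (hb' ▸ ha)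

theorem Rooted.congr {S' : Set V} (h : Rooted G S X) (hS : ∀ x ∈ X, x ∈ S → x ∈ S') :
    Rooted G S' X := by
  intro A hA hne
  obtain ⟨a, ha, haS⟩ := h A hA hne
  exact ⟨a, ha, hS a (hA.subset ha) haS⟩

/-- If some vertex of `X` is adjacent to all of `X ∩ S`, then `X` is connected as soon as it is
rooted at `S`. -/
theorem Rooted.conn_of_adj (h : Rooted G S X) {z : V} (hz : z ∈ X)
    (hadj : ∀ s ∈ X, s ∈ S → G.Adj s z) : Conn G X := by
  have : Rooted G {z} X := by
    intro A hA hne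
    obtain ⟨s, hs, hsS⟩ := h A hA hne
    exact ⟨z, hA.mem_of_adj s hs z hz (hadj s (hA.subset hs) hsS), rfl⟩
  exact this.conn

/-- A rooted set can be built up from the empty set by adding roots or neighbours of earlier
vertices; the last vertex added may be claimed. Hence the rooted game never gets stuck. -/
theorem Rooted.exists_erase [DecidableEq V] {U : Finset V} (h : Rooted G S (U : Set V))
    (hU : U.Nonempty) : ∃ v ∈ U, Rooted G S (U.erase v : Finset V) := by
  classical
  -- A largest proper rooted subset; by maximality it turns out to miss a single vertex.
  obtain ⟨K, hK, hmax⟩ := Finset.exists_max_image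
    (U.ssubsets.filter fun K : Finset V => Rooted G S (K : Set V)) Finset.card
    ⟨∅, by simpa [Finset.ssubset_iff_subset_ne, hU.ne_empty.symm] using rooted_empty⟩
  rw [Finset.mem_filter, Finset.mem_ssubsets] at hK
  obtain ⟨z, hzU, hzK, hz⟩ : ∃ z ∈ U, z ∉ K ∧ (z ∈ S ∨ ∃ b ∈ K, G.Adj z b) := by
    by_contra! hcon
    have hcl : ClosedIn G (U : Set V) (U \ K : Finset V) := by
      refine ⟨by simp, fun a ha b hb hab => ?_⟩
      rw [Finset.mem_coe, Finset.mem_sdiff] at ha ⊢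
      exact ⟨hb, fun hbK => (hcon a ha.1 ha.2).2 b hbK hab⟩
    obtain ⟨s, hs, hsS⟩ := h _ hcl (by
      obtain ⟨z, hz, hz'⟩ := Finset.exists_of_ssubset hK.1
      exact ⟨z, by simp [hz, hz']⟩)
    rw [Finset.mem_coe, Finset.mem_sdiff] at hs
    exact (hcon s hs.1 hs.2).1 hsS
  have hins : Rooted G S (insert z K : Finset V) := by
    intro A hA hne
    by_cases hAK : (A ∩ K).Nonempty
    · have : ClosedIn G (K : Set V) (A ∩ K) :=
        ⟨Set.inter_subset_right, fun a ha b hb hab =>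
          ⟨hA.mem_of_adj a ha.1 b (by simpa using Or.inr hb) hab, hb⟩⟩
      obtain ⟨s, hs, hsS⟩ := hK.2 _ this hAK
      exact ⟨s, hs.1, hsS⟩
    · obtain ⟨a, ha⟩ := hne
      have haz : a = z := by
        have := hA.subset ha
        rw [Finset.mem_coe, Finset.mem_insert] at this
        exact this.resolve_right fun haK => hAK ⟨a, ha, haK⟩
      subst haz
      rcases hz with hz | ⟨b, hb, hab⟩
      · exact ⟨a, ha, hz⟩
      · exact absurd ⟨b, hA.mem_of_adj a ha b (by simp [hb]) hab, hb⟩ hAK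
  have hU' : insert z K = U := by
    by_contra hne
    have := hmax (insert z K) (by
      rw [Finset.mem_filter, Finset.mem_ssubsets, Finset.ssubset_iff_subset_ne]
      exact ⟨⟨Finset.insert_subset hzU hK.1.subset, hne⟩, hins⟩)
    rw [Finset.card_insert_of_notMem hzK] at this
    omega
  refine ⟨z, hzU, ?_⟩
  rw [← hU', Finset.erase_insert hzK]
  exact hK.2

theorem Conn.exists_erase [DecidableEq V] {U : Finset V} (h : Conn G (U : Set V))
    (hU : U.Nonempty) : ∃ v ∈ U, Conn G (U.erase v : Finset V) := by
  obtain ⟨r, hr⟩ := hU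
  have hrt : Rooted G {r} (U : Set V) := h.rooted ⟨r, hr, rfl⟩
  obtain ⟨v, hv, hv'⟩ := hrt.exists_erase ⟨r, hr⟩
  exact ⟨v, hv, hv'.conn⟩

end Connectivity

/-! ### The value of a game -/

section Value

variable {V : Type*} [DecidableEq V]

/-- The difference between the scores of the player to move and of the other player, when `U` is the
set of remaining vertices and `v ∈ U` may be claimed if `L (U.erase v)`. -/
noncomputable def val (L : Finset V → Prop) (w : V → ℝ) (U : Finset V) : ℝ :=
  ⨆ v : {v : V // v ∈ U ∧ L (U.erase v)}, (w v.1 - val L w (U.erase v.1))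
termination_by U.card
decreasing_by exact Finset.card_erase_lt_of_mem v.2.1

variable {L : Finset V → Prop} {w : V → ℝ} {U : Finset V}

instance finite_moves : Finite {v : V // v ∈ U ∧ L (U.erase v)} :=
  Set.Finite.subset U.finite_toSet fun _ h => h.1

theorem le_val {v : V} (hv : v ∈ U) (hL : L (U.erase v)) :
    w v - val L w (U.erase v) ≤ val L w U := by
  rw [val.eq_1 L w U]
  exact le_ciSup (f := fun v : {v : V // v ∈ U ∧ L (U.erase v)} => w v.1 - val L w (U.erase v.1))
    (Set.finite_range _).bddAbove ⟨v, hv, hL⟩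

theorem exists_val_eq (h : ∃ v ∈ U, L (U.erase v)) :
    ∃ v ∈ U, L (U.erase v) ∧ val L w U = w v - val L w (U.erase v) := by
  obtain ⟨v, hv, hL⟩ := h
  have : Nonempty {v : V // v ∈ U ∧ L (U.erase v)} := ⟨⟨v, hv, hL⟩⟩
  obtain ⟨u, hu⟩ := exists_eq_ciSup_of_finite
    (f := fun v : {v : V // v ∈ U ∧ L (U.erase v)} => w v.1 - val L w (U.erase v.1))
  refine ⟨u.1, u.2.1, u.2.2, ?_⟩
  rw [val.eq_1 L w U]
  exact hu.symm

/-- The supremum of an empty family of reals is 0 by convention, which is the right value of a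
finished game. -/
theorem val_empty : val L w ∅ = 0 := by
  rw [val.eq_1]
  have : IsEmpty {v : V // v ∈ (∅ : Finset V) ∧ L ((∅ : Finset V).erase v)} :=
    ⟨fun v => absurd v.2.1 (Finset.notMem_empty _)⟩
  exact Real.iSup_of_isEmpty _

theorem val_congr {L' : Finset V → Prop} (h : ∀ Z ⊆ U, (L Z ↔ L' Z)) :
    val L w U = val L' w U := by
  induction U using Finset.strongInduction with
  | H U ih =>
    rw [val.eq_1 L w U, val.eq_1 L' w U]
    refine Equiv.iSup_congr (Equiv.subtypeEquivRight fun v => by rw [h _ (Finset.erase_subset v U)])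
      fun v => ?_
    have := ih (U.erase v.1) (Finset.erase_ssubset v.2.1)
      fun Z hZ => h Z (hZ.trans (Finset.erase_subset v.1 U))
    simp [this]

/-- The two scores in terms of the value, if there is always a legal move. -/
theorem score_eq {feasible : Finset V → V → Prop} (hf : ∀ U v, feasible U v ↔ L (U.erase v))
    (hplay : ∀ U, L U → U.Nonempty → ∃ v ∈ U, L (U.erase v)) (w : V → ℝ≥0) (hU : L U) :
    ((score feasible w U).1 : ℝ) = (∑ v ∈ U, (w v : ℝ) + val L (fun v => w v) U) / 2 ∧
    ((score feasible w U).2 : ℝ) = (∑ v ∈ U, (w v : ℝ) - val L (fun v => w v) U) / 2 := by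
  induction U using Finset.strongInduction with
  | H U ih =>
    have hff : feasible = fun U v => L (U.erase v) := by
      ext U v
      exact hf U v
    subst hff
    rcases U.eq_empty_or_nonempty with rfl | hne
    · rw [score.eq_1]
      have : IsEmpty {v : V // v ∈ (∅ : Finset V) ∧ L ((∅ : Finset V).erase v)} :=
        ⟨fun v => absurd v.2.1 (Finset.notMem_empty _)⟩
      rw [val_empty, ciSup_of_empty, NNReal.iInf_empty]
      simp
    have hmove := hplay U hU hne
    obtain ⟨u, huU, huL, hu⟩ := exists_val_eq (w := fun v => (w v : ℝ)) hmove
    have : Nonempty {v : V // v ∈ U ∧ L (U.erase v)} := ⟨⟨u, huU, huL⟩⟩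
    have hsum : ∀ v ∈ U, ∑ x ∈ U, (w x : ℝ) = w v + ∑ x ∈ U.erase v, (w x : ℝ) :=
      fun v hv => (Finset.add_sum_erase U (fun x => (w x : ℝ)) hv).symm
    have hle : ∀ v ∈ U, L (U.erase v) →
        (w v : ℝ) - val L (fun v => (w v : ℝ)) (U.erase v) ≤ val L (fun v => (w v : ℝ)) U :=
      fun v hv hL => le_val (w := fun v => (w v : ℝ)) hv hL
    have ih' := fun v hv hL => ih (U.erase v) (Finset.erase_ssubset hv) hL
    rw [score.eq_1]
    constructor
    · obtain ⟨v, hv⟩ := exists_eq_ciSup_of_finite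
        (f := fun v : {v : V // v ∈ U ∧ L (U.erase v)} =>
          w v.1 + (score (fun U v => L (U.erase v)) w (U.erase v.1)).2)
      have hub := le_ciSup (f := fun v : {v : V // v ∈ U ∧ L (U.erase v)} =>
          w v.1 + (score (fun U v => L (U.erase v)) w (U.erase v.1)).2)
          (Set.finite_range _).bddAbove ⟨u, huU, huL⟩
      rw [← hv] at hub ⊢
      have hub' : (w u : ℝ) + ((score (fun U v => L (U.erase v)) w (U.erase u)).2 : ℝ) ≤
          w v.1 + ((score (fun U v => L (U.erase v)) w (U.erase v.1)).2 : ℝ) := by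
        exact_mod_cast hub
      have h1 := (ih' v.1 v.2.1 v.2.2).2
      have h2 := (ih' u huU huL).2
      have h3 := hle v.1 v.2.1 v.2.2
      have h4 := hsum v.1 v.2.1
      have h5 := hsum u huU
      push_cast
      linarith
    · obtain ⟨v, hv⟩ := exists_eq_ciInf_of_finite
        (f := fun v : {v : V // v ∈ U ∧ L (U.erase v)} =>
          (score (fun U v => L (U.erase v)) w (U.erase v.1)).1)
      have hub := ciInf_le (f := fun v : {v : V // v ∈ U ∧ L (U.erase v)} =>
          (score (fun U v => L (U.erase v)) w (U.erase v.1)).1)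
          (Set.finite_range _).bddBelow ⟨u, huU, huL⟩
      rw [← hv] at hub ⊢
      have hub' : ((score (fun U v => L (U.erase v)) w (U.erase v.1)).1 : ℝ) ≤
          ((score (fun U v => L (U.erase v)) w (U.erase u)).1 : ℝ) := by
        exact_mod_cast hub
      have h1 := (ih' v.1 v.2.1 v.2.2).1
      have h2 := (ih' u huU huL).1
      have h3 := hle v.1 v.2.1 v.2.2
      have h4 := hsum v.1 v.2.1
      have h5 := hsum u huU
      linarith

end Value

/-! ### Games on a graph with a split -/

/-- The edges between the disjoint sets `B` and `C` are exactly those between `P ⊆ B` and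
`Q ⊆ C`. -/
structure IsSplit {V : Type*} (G : SimpleGraph V) (B C : Finset V) (P Q : Set V) : Prop where
  disjoint : Disjoint B C
  left_subset : P ⊆ B
  right_subset : Q ⊆ C
  adj_iff : ∀ b ∈ B, ∀ c ∈ C, G.Adj b c ↔ b ∈ P ∧ c ∈ Q

section Split

variable {V : Type*} {G : SimpleGraph V} {B C X Y : Finset V} {P Q : Set V}

theorem IsSplit.symm (h : IsSplit G B C P Q) : IsSplit G C B Q P where
  disjoint := h.disjoint.symm
  left_subset := h.right_subset
  right_subset := h.left_subset
  adj_iff c hc b hb := by rw [G.adj_comm, h.adj_iff b hb c hc, and_comm]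

theorem IsSplit.notMem_right (h : IsSplit G B C P Q) {x : V} (hx : x ∈ B) : x ∉ C :=
  Finset.disjoint_left.1 h.disjoint hx

variable [DecidableEq V]

/-- Edges between the parts join P to Q, and every vertex of Q sees all of P. So a component inside
Y reaches a root exactly when it contains a vertex of Q and some vertex of P is left. The rooted
game on the union is thus a sum of two rooted games, with the single restriction that X must not be
exhausted before Y. -/
theorem IsSplit.rooted_iff (h : IsSplit G B C P Q) (hX : X ⊆ B) (hY : Y ⊆ C) :
    Rooted G P (X ∪ Y : Finset V) ↔
      Rooted G P X ∧ Rooted G Q Y ∧ (Y.Nonempty → X.Nonempty) := by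
  constructor
  · intro hr
    refine ⟨fun A hA hne => ?_, fun A hA hne => ?_, fun hne => ?_⟩
    · by_contra hcon
      refine hcon (hr A ⟨fun a ha => ?_, fun a ha b hb hab => ?_⟩ hne)
      · have := hA.subset ha
        simp only [Finset.coe_union, Set.mem_union]
        exact Or.inl this
      · rcases Finset.mem_union.1 hb with hb | hb
        · exact hA.mem_of_adj a ha b hb hab
        · exact absurd ⟨a, ha, ((h.adj_iff a (hX (hA.subset ha)) b (hY hb)).1 hab).1⟩ hcon
    · by_contra hcon
      have hcl : ClosedIn G (X ∪ Y : Finset V) A := by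
        refine ⟨fun a ha => Finset.mem_union_right _ (hA.subset ha), fun a ha b hb hab => ?_⟩
        rcases Finset.mem_union.1 hb with hb | hb
        · exact absurd ⟨a, ha, ((h.adj_iff b (hX hb) a (hY (hA.subset ha))).1 hab.symm).2⟩ hcon
        · exact hA.mem_of_adj a ha b hb hab
      obtain ⟨p, hp, hpP⟩ := hr A hcl hne
      exact h.notMem_right (h.left_subset hpP) (hY (hA.subset hp))
    · obtain ⟨y, hy⟩ := hne
      obtain ⟨p, hp, hpP⟩ := hr.nonempty ⟨y, by simp [hy]⟩
      refine ⟨p, (Finset.mem_union.1 hp).resolve_right fun hpY => ?_⟩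
      exact h.notMem_right (h.left_subset hpP) (hY hpY)
  · rintro ⟨hP, hQ, hne⟩ A hA ⟨a, ha⟩
    by_cases hAX : (A ∩ X).Nonempty
    · obtain ⟨p, hp, hpP⟩ := hP (A ∩ X) ⟨Set.inter_subset_right, fun a ha b hb hab =>
        ⟨hA.mem_of_adj a ha.1 b (Finset.mem_union_left _ hb) hab, hb⟩⟩ hAX
      exact ⟨p, hp.1, hpP⟩
    · have hAY : A ⊆ Y := fun b hb =>
        (Finset.mem_union.1 (hA.subset hb)).resolve_left fun hbX => hAX ⟨b, hb, hbX⟩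
      obtain ⟨q, hq, hqQ⟩ := hQ A ⟨hAY, fun a ha b hb hab =>
        hA.mem_of_adj a ha b (Finset.mem_union_right _ hb) hab⟩ ⟨a, ha⟩
      obtain ⟨x, hx⟩ := hne ⟨a, hAY ha⟩
      obtain ⟨p, hp, hpP⟩ := hP.nonempty ⟨x, hx⟩
      exact ⟨p, hA.mem_of_adj q hq p (Finset.mem_union_left _ hp)
        ((h.adj_iff p (hX hp) q (hY (hAY hq))).2 ⟨hpP, hqQ⟩).symm, hpP⟩

theorem IsSplit.erase_left (h : IsSplit G B C P Q) (hX : X ⊆ B) (hY : Y ⊆ C) {v : V}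
    (hv : v ∈ X) : (X ∪ Y).erase v = X.erase v ∪ Y := by
  rw [Finset.erase_union_distrib,
    Finset.erase_eq_of_notMem fun hvY => h.notMem_right (hX hv) (hY hvY)]

theorem IsSplit.erase_right (h : IsSplit G B C P Q) (hX : X ⊆ B) (hY : Y ⊆ C) {v : V}
    (hv : v ∈ Y) : (X ∪ Y).erase v = X ∪ Y.erase v := by
  rw [Finset.union_comm, h.symm.erase_left hY hX hv, Finset.union_comm]

variable {w : V → ℝ}

/-- The value of the game rooted at `S`. -/
noncomputable abbrev rootedVal (G : SimpleGraph V) (w : V → ℝ) (S : Set V) (U : Finset V) : ℝ :=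
  val (fun Z : Finset V => Rooted G S Z) w U

theorem exists_rootedVal_eq {S : Set V} {U : Finset V} (h : Rooted G S U) (hU : U.Nonempty) :
    ∃ v ∈ U, Rooted G S (U.erase v : Finset V) ∧
      rootedVal G w S U = w v - rootedVal G w S (U.erase v) :=
  exists_val_eq (L := fun Z : Finset V => Rooted G S Z) (h.exists_erase hU)

theorem rootedVal_congr {S S' : Set V} {U : Finset V} (h : ∀ x ∈ U, x ∈ S ↔ x ∈ S') :
    rootedVal G w S U = rootedVal G w S' U :=
  val_congr fun _ hZ => ⟨fun hr => hr.congr fun x hx => (h x (hZ hx)).1,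
    fun hr => hr.congr fun x hx => (h x (hZ hx)).2⟩

/-- The player not to move answers in the part in which the opponent has just moved. -/
theorem IsSplit.rootedVal_union_le (h : IsSplit G B C P Q) (n : ℕ) :
    ∀ X Y : Finset V, X.card + Y.card = n → X ⊆ B → Y ⊆ C → Rooted G P X → Rooted G Q Y →
      Odd X.card → Even Y.card →
      rootedVal G w P (X ∪ Y) ≤ rootedVal G w P X + rootedVal G w Q Y := by
  induction n using Nat.strong_induction_on with
  | _ n ih =>
  rintro X Y hn hX hY hPX hQY hodd heven
  have hXne : X.Nonempty := Finset.card_pos.1 hodd.pos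
  obtain ⟨v, hv, hvr, hval⟩ := exists_rootedVal_eq (w := w)
    ((h.rooted_iff hX hY).2 ⟨hPX, hQY, fun _ => hXne⟩) (hXne.mono Finset.subset_union_left)
  rw [hval]
  rcases Finset.mem_union.1 hv with hvX | hvY
  · rw [h.erase_left hX hY hvX] at hvr ⊢
    have hXv : X.erase v ⊆ B := (Finset.erase_subset _ _).trans hX
    obtain ⟨hPv, -, hne⟩ := (h.rooted_iff hXv hY).1 hvr
    have hle : w v - rootedVal G w P (X.erase v) ≤ rootedVal G w P X := le_val hvX hPv
    have hc1 := Finset.card_erase_add_one hvX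
    -- The only situation without an answer in the same part: the last vertex of X was claimed,
    -- which is legal only if Y is already exhausted. Otherwise the answer restores the odd size of
    -- X, so X stays non-empty.
    rcases (X.erase v).eq_empty_or_nonempty with hemp | hXvne
    · have hYe : Y = ∅ := by
        by_contra hYe
        exact (hne (Finset.nonempty_iff_ne_empty.2 hYe)).ne_empty hemp
      subst hYe
      have : rootedVal G w Q ∅ = 0 := val_empty
      rw [Finset.union_empty, this]
      linarith
    · obtain ⟨x, hx, hxr, hxval⟩ := exists_rootedVal_eq (w := w) hPv hXvne
      have hc2 := Finset.card_erase_add_one hx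
      have hXx : (X.erase v).erase x ⊆ B := (Finset.erase_subset _ _).trans hXv
      have hodd' : Odd ((X.erase v).erase x).card := by
        rw [← hc1, ← hc2] at hodd
        simpa [parity_simps] using hodd
      have := ih (((X.erase v).erase x).card + Y.card) (by omega) _ Y rfl hXx hY hxr hQY hodd' heven
      have hle2 : w x - rootedVal G w P ((X.erase v ∪ Y).erase x) ≤
          rootedVal G w P (X.erase v ∪ Y) := le_val (Finset.mem_union_left _ hx) (by
        rw [h.erase_left hXv hY hx]
        exact (h.rooted_iff hXx hY).2 ⟨hxr, hQY, fun _ => Finset.card_pos.1 hodd'.pos⟩)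
      rw [h.erase_left hXv hY hx] at hle2
      linarith
  · rw [h.erase_right hX hY hvY] at hvr ⊢
    have hYv : Y.erase v ⊆ C := (Finset.erase_subset _ _).trans hY
    obtain ⟨-, hQv, -⟩ := (h.rooted_iff hX hYv).1 hvr
    have hle : w v - rootedVal G w Q (Y.erase v) ≤ rootedVal G w Q Y := le_val hvY hQv
    have hc1 := Finset.card_erase_add_one hvY
    have hodd1 : Odd (Y.erase v).card := by
      rw [← hc1] at heven
      simpa [parity_simps] using heven
    obtain ⟨y, hy, hyr, hyval⟩ := exists_rootedVal_eq (w := w) hQv (Finset.card_pos.1 hodd1.pos)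
    have hc2 := Finset.card_erase_add_one hy
    have hYy : (Y.erase v).erase y ⊆ C := (Finset.erase_subset _ _).trans hYv
    have heven' : Even ((Y.erase v).erase y).card := by
      rw [← hc2] at hodd1
      simpa [parity_simps] using hodd1
    have := ih (X.card + ((Y.erase v).erase y).card) (by omega) X _ rfl hX hYy hPX hyr hodd heven'
    have hle2 : w y - rootedVal G w P ((X ∪ Y.erase v).erase y) ≤
        rootedVal G w P (X ∪ Y.erase v) := le_val (Finset.mem_union_right _ hy) (by
      rw [h.erase_right hX hYv hy]
      exact (h.rooted_iff hX hYy).2 ⟨hPX, hyr, fun _ => hXne⟩)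
    rw [h.erase_right hX hYv hy] at hle2
    linarith

/-- Opening with an optimal move of the game on C leaves an odd B and an even remainder of C, where
the opponent's advantage is bounded by answering in the same part. -/
theorem IsSplit.le_rootedVal_of_odd (h : IsSplit G B C P Q) (hPB : Rooted G P B)
    (hQC : Rooted G Q C) (hB : Odd B.card) (hC : Odd C.card) :
    rootedVal G w Q C - rootedVal G w P B ≤ rootedVal G w P (B ∪ C) := by
  obtain ⟨y, hy, hyr, hyval⟩ := exists_rootedVal_eq (w := w) hQC (Finset.card_pos.1 hC.pos)
  have hCy := Finset.erase_subset y C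
  have hc := Finset.card_erase_add_one hy
  have heven : Even (C.erase y).card := by
    rw [← hc] at hC
    simpa [parity_simps] using hC
  have h1 := h.rootedVal_union_le (w := w) _ B _ rfl subset_rfl hCy hPB hyr hB heven
  have h2 : w y - rootedVal G w P ((B ∪ C).erase y) ≤ rootedVal G w P (B ∪ C) :=
    le_val (Finset.mem_union_right _ hy) (by
      rw [h.erase_right subset_rfl subset_rfl hy]
      exact (h.rooted_iff subset_rfl hCy).2 ⟨hPB, hyr, fun _ => Finset.card_pos.1 hB.pos⟩)
  rw [h.erase_right subset_rfl subset_rfl hy] at h2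
  linarith

/-- Here the opening move is made in B, so that again the part containing the roots is odd when the
opponent is to move. -/
theorem IsSplit.le_rootedVal_of_even (h : IsSplit G B C P Q) (hPB : Rooted G P B)
    (hQC : Rooted G Q C) (hBne : B.Nonempty) (hB : Even B.card) (hC : Even C.card) :
    rootedVal G w P B - rootedVal G w Q C ≤ rootedVal G w P (B ∪ C) := by
  obtain ⟨x, hx, hxr, hxval⟩ := exists_rootedVal_eq (w := w) hPB hBne
  have hBx := Finset.erase_subset x B
  have hc := Finset.card_erase_add_one hx
  have hodd : Odd (B.erase x).card := by
    rw [← hc] at hB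
    simpa [parity_simps] using hB
  have h1 := h.rootedVal_union_le (w := w) _ _ C rfl hBx subset_rfl hxr hQC hodd hC
  have h2 : w x - rootedVal G w P ((B ∪ C).erase x) ≤ rootedVal G w P (B ∪ C) :=
    le_val (Finset.mem_union_left _ hx) (by
      rw [h.erase_left subset_rfl subset_rfl hx]
      exact (h.rooted_iff hBx subset_rfl).2 ⟨hxr, hQC, fun _ => Finset.card_pos.1 hodd.pos⟩)
  rw [h.erase_left subset_rfl subset_rfl hx] at h2
  linarith

/-- Both parts have the same parity. The lower bounds for the games rooted at P and at Q come from
the same estimate with the parts exchanged, and they cancel. -/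
theorem IsSplit.rootedVal_add_nonneg (h : IsSplit G B C P Q) (hP : Rooted G P (B ∪ C : Finset V))
    (hBne : B.Nonempty) (hCne : C.Nonempty) (heven : Even (B ∪ C).card) :
    0 ≤ rootedVal G w P (B ∪ C) + rootedVal G w Q (B ∪ C) := by
  obtain ⟨hPB, hQC, -⟩ := (h.rooted_iff subset_rfl subset_rfl).1 hP
  rw [Finset.card_union_of_disjoint h.disjoint, Nat.even_add] at heven
  rcases Nat.even_or_odd B.card with hB | hB
  · have h1 := h.le_rootedVal_of_even (w := w) hPB hQC hBne hB (heven.1 hB)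
    have h2 := h.symm.le_rootedVal_of_even (w := w) hQC hPB hCne (heven.1 hB) hB
    rw [Finset.union_comm C B] at h2
    linarith
  · have hC : Odd C.card := by
      rw [← Nat.not_even_iff_odd] at hB ⊢
      exact fun hC => hB (heven.2 hC)
    have h1 := h.le_rootedVal_of_odd (w := w) hPB hQC hB hC
    have h2 := h.symm.le_rootedVal_of_odd (w := w) hQC hPB hC hB
    rw [Finset.union_comm C B] at h2
    linarith

/-! ### A single root and its neighbourhood -/

theorem rooted_insert_iff {y : V} {Z : Finset V} (hy : y ∉ Z) :
    Rooted G {y} (insert y Z : Finset V) ↔ Rooted G (G.neighborSet y) Z := by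
  constructor
  · intro h A hA hne
    by_contra hcon
    have hcl : ClosedIn G (insert y Z : Finset V) A := by
      refine ⟨fun a ha => Finset.mem_insert_of_mem (hA.subset ha), fun a ha b hb hab => ?_⟩
      rcases Finset.mem_insert.1 hb with rfl | hb
      · exact absurd ⟨a, ha, hab.symm⟩ hcon
      · exact hA.mem_of_adj a ha b hb hab
    obtain ⟨a, ha, rfl⟩ := h A hcl hne
    exact hy (hA.subset ha)
  · intro h A hA hne
    by_contra hcon
    have hyA : y ∉ A := fun hyA => hcon ⟨y, hyA, rfl⟩
    obtain ⟨a, ha, hay⟩ := h A ⟨fun a ha =>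
      (Finset.mem_insert.1 (hA.subset ha)).resolve_left fun h => hyA (h ▸ ha),
      fun a ha b hb hab => hA.mem_of_adj a ha b (Finset.mem_insert_of_mem hb) hab⟩ hne
    exact hyA (hA.mem_of_adj a ha y (Finset.mem_insert_self _ _) hay.symm)

/-- In the game rooted at `y`, the vertex `y` is claimed last. -/
theorem rootedVal_insert {y : V} {Z : Finset V} (hy : y ∉ Z)
    (hZ : Rooted G (G.neighborSet y) Z) :
    rootedVal G w {y} (insert y Z) =
      rootedVal G w (G.neighborSet y) Z + (-1) ^ Z.card * w y := by
  induction Z using Finset.strongInduction with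
  | H Z ih =>
    have hroot := (rooted_insert_iff hy).2 hZ
    rcases Z.eq_empty_or_nonempty with rfl | hne
    · obtain ⟨v, hv, -, hval⟩ := exists_rootedVal_eq (w := w) hroot (by simp)
      obtain rfl : v = y := by simpa using hv
      have h0 : ∀ S, rootedVal G w S ∅ = 0 := fun S => val_empty
      rw [hval]
      simp [h0]
    -- One move changes both the sign of the value and the parity of the remaining set, so the
    -- contribution of y keeps its form.
    · have key : ∀ v ∈ Z, Rooted G (G.neighborSet y) (Z.erase v : Finset V) →
          (insert y Z).erase v = insert y (Z.erase v) ∧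
          w v - rootedVal G w {y} (insert y (Z.erase v)) =
            w v - rootedVal G w (G.neighborSet y) (Z.erase v) + (-1) ^ Z.card * w y := by
        intro v hv hr
        refine ⟨Finset.erase_insert_of_ne fun h => hy (h ▸ hv), ?_⟩
        rw [ih _ (Finset.erase_ssubset hv) (fun h => hy (Finset.mem_of_mem_erase h)) hr,
          ← Finset.card_erase_add_one hv, pow_succ]
        ring
      apply le_antisymm
      · obtain ⟨v, hv, hvr, hval⟩ := exists_rootedVal_eq (w := w) hroot (by simp)
        have hvy : v ≠ y := by
          rintro rfl
          rw [Finset.erase_insert hy] at hvr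
          obtain ⟨a, ha, rfl⟩ := hvr.nonempty hne
          exact hy ha
        have hvZ := (Finset.mem_insert.1 hv).resolve_left hvy
        rw [Finset.erase_insert_of_ne hvy.symm] at hvr hval
        have hvr' := (rooted_insert_iff fun h => hy (Finset.mem_of_mem_erase h)).1 hvr
        rw [hval, (key v hvZ hvr').2]
        have : w v - rootedVal G w (G.neighborSet y) (Z.erase v) ≤
          rootedVal G w (G.neighborSet y) Z := le_val hvZ hvr'
        linarith
      · obtain ⟨v, hv, hvr, hval⟩ := exists_rootedVal_eq (w := w) hZ hne
        obtain ⟨h1, h2⟩ := key v hv hvr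
        have : w v - rootedVal G w {y} ((insert y Z).erase v) ≤ rootedVal G w {y} (insert y Z) :=
          le_val (Finset.mem_insert_of_mem hv) (by
            rw [h1]
            exact (rooted_insert_iff fun h => hy (Finset.mem_of_mem_erase h)).2 hvr)
        rw [h1, h2] at this
        rw [hval]
        exact this

end Split

/-! ### Families of root sets -/

/-- A family of root sets which is closed under passing from a vertex to its neighbours in a
component of the rest of a connected set, and in which all sets with at least two remaining
vertices come from splits. -/
structure IsRootFamily {V : Type*} [DecidableEq V] (G : SimpleGraph V) (F : Set (Set V)) :
    Prop where
  exists_eq_neighbors : ∀ U C : Finset V, ∀ v ∈ U, Conn G (U : Set V) → Conn G (C : Set V) →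
    C.Nonempty → ClosedIn G (U.erase v : Finset V) (C : Set V) →
    ∃ S ∈ F, ∀ x, x ∈ U ∧ x ∈ S ↔ x ∈ C ∧ G.Adj v x
  exists_split : ∀ U : Finset V, Conn G (U : Set V) → ∀ S ∈ F, (U ∩ S : Set V).Nontrivial →
    ∃ B C : Finset V, ∃ S' ∈ F, U = B ∪ C ∧ C.Nonempty ∧ IsSplit G B C (U ∩ S) (U ∩ S')

section Induction

variable {V : Type*} [DecidableEq V] {G : SimpleGraph V} {F : Set (Set V)} {w : V → ℝ}

/-! ### Comparing the rooted and the unrooted game -/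

/-- The value of the game without roots. -/
noncomputable abbrev connVal (G : SimpleGraph V) (w : V → ℝ) (U : Finset V) : ℝ :=
  val (fun Z : Finset V => Conn G (Z : Set V)) w U

/-- The comparison between the rooted and the unrooted game for sets with `n` vertices. -/
def Comparison (G : SimpleGraph V) (w : V → ℝ) (S : Set V) (n : ℕ) : Prop :=
  ∀ U : Finset V, U.card = n → Conn G (U : Set V) → (U ∩ S : Set V).Nonempty →
    (Odd n → connVal G w U ≤ rootedVal G w S U) ∧
    (Even n → 0 ≤ connVal G w U + rootedVal G w S U)

/-- If all moves in the rooted game are moves in the unrooted game, then the odd case yields an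
upper bound for the value of the rooted game in the even case. -/
theorem rootedVal_le_connVal {S : Set V} {U : Finset V} (hU : U.Nonempty) (heven : Even U.card)
    (hr : Rooted G S (U : Set V))
    (hodd : ∀ y ∈ U, Rooted G S (U.erase y : Finset V) → ¬ Conn G (U.erase y : Finset V) →
      w y - rootedVal G w S (U.erase y) ≤ connVal G w U)
    (ih : Comparison G w S (U.card - 1)) : rootedVal G w S U ≤ connVal G w U := by
  obtain ⟨y, hy, hyr, hval⟩ := exists_rootedVal_eq (w := w) hr hU
  rw [hval]
  by_cases hc : Conn G (U.erase y : Finset V)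
  · have hcard := Finset.card_erase_of_mem hy
    have hcard' := Finset.card_erase_add_one hy
    have hodd' : Odd (U.erase y).card := by
      rw [← hcard'] at heven
      simpa [parity_simps] using heven
    have hne : (U.erase y).Nonempty := Finset.card_pos.1 hodd'.pos
    have h1 := (ih _ hcard hc (hyr.nonempty hne)).1 (hcard ▸ hodd')
    have h2 : w y - connVal G w (U.erase y) ≤ connVal G w U := le_val hy hc
    linarith
  · exact hodd y hy hyr hc

theorem exists_component {U : Finset V} {v : V}
    (hv : v ∈ U) (hcard : 2 ≤ U.card) : ∃ C : Finset V, C.Nonempty ∧ Conn G (C : Set V) ∧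
      ClosedIn G (U.erase v : Finset V) (C : Set V) := by
  classical
  have hne : (U.erase v).Nonempty := by
    rw [← Finset.card_pos, Finset.card_erase_of_mem hv]
    omega
  -- A component is obtained as a smallest non-empty union of components.
  obtain ⟨C, hC, hmin⟩ := Finset.exists_min_image
    ((U.erase v).powerset.filter fun C : Finset V =>
      C.Nonempty ∧ ClosedIn G (U.erase v : Finset V) (C : Set V)) Finset.card
    ⟨U.erase v, by simpa using ⟨hne, ClosedIn.refl⟩⟩
  rw [Finset.mem_filter, Finset.mem_powerset] at hC
  refine ⟨C, hC.2.1, fun A hA hAne => ?_, hC.2.2⟩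
  have hfin : A.Finite := C.finite_toSet.subset hA.subset
  lift A to Finset V using hfin
  have hAC : A ⊆ C := by exact_mod_cast hA.subset
  have := hmin A (by
    rw [Finset.mem_filter, Finset.mem_powerset]
    refine ⟨hAC.trans hC.1, by exact_mod_cast hAne, fun a ha => hC.1 (hAC ha),
      fun a ha b hb hab => ?_⟩
    exact hA.mem_of_adj a ha b (hC.2.2.mem_of_adj a (hAC ha) b hb hab) hab)
  rw [Finset.eq_of_subset_of_card_le hAC this]

/-- The even case for a single root. -/
theorem IsRootFamily.comparison_singleton (hF : IsRootFamily G F) {n : ℕ} (hn : Even n)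
    (ih : ∀ S ∈ F, Comparison G w S (n - 1)) {U : Finset V} (hcard : U.card = n)
    (hU : Conn G (U : Set V)) {v : V} (hv : v ∈ U) :
    0 ≤ connVal G w U + rootedVal G w {v} U := by
  subst hcard
  have hpos : 0 < U.card := Finset.card_pos.2 ⟨v, hv⟩
  obtain ⟨C, hCne, hC, hcl⟩ := exists_component (G := G) hv (by
    obtain ⟨m, hm⟩ := hn
    omega)
  obtain ⟨S, hS, hSC⟩ := hF.exists_eq_neighbors U C v hv hU hC hCne hcl
  have hCU : C ⊆ U.erase v := by exact_mod_cast hcl.subset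
  have hvC : v ∉ C := fun h => Finset.notMem_erase v U (hCU h)
  -- Only v has neighbours in the component C of the rest, so v against its neighbours in C is a
  -- split.
  have hsplit : IsSplit G (U \ C) C {v} (U ∩ S) := by
    refine ⟨Finset.sdiff_disjoint, ?_, fun x hx => ((hSC x).1 hx).1, fun b hb c hc => ?_⟩
    · rintro _ rfl
      simp [hv, hvC]
    · rw [Finset.mem_sdiff] at hb
      have hcS := hSC c
      constructor
      · intro hbc
        have : b = v := by
          by_contra hbv
          exact hb.2 (hcl.mem_of_adj c hc b (by simp [hb.1, hbv]) hbc.symm)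
        subst this
        exact ⟨rfl, hcS.2 ⟨hc, hbc⟩⟩
      · rintro ⟨rfl, hc'⟩
        exact (hcS.1 hc').2
  have hUeq : U \ C ∪ C = U := Finset.sdiff_union_of_subset (hCU.trans (Finset.erase_subset _ _))
  have hvroot : Rooted G {v} (U : Set V) := hU.rooted ⟨v, hv, rfl⟩
  have h1 := hsplit.rootedVal_add_nonneg (w := w) (by rwa [hUeq]) ⟨v, by simp [hv, hvC]⟩ hCne
    (by rwa [hUeq])
  rw [hUeq] at h1
  have hcongr : rootedVal G w (U ∩ S) U = rootedVal G w S U :=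
    rootedVal_congr fun x hx => ⟨fun h => h.2, fun h => ⟨hx, h⟩⟩
  rw [hcongr] at h1
  have hSne : (U ∩ S : Set V).Nonempty := by
    obtain ⟨hr1, hr2, -⟩ := (hsplit.rooted_iff subset_rfl subset_rfl).1 (by rwa [hUeq])
    exact (hr2.nonempty hCne).mono Set.inter_subset_right
  have h2 : rootedVal G w S U ≤ connVal G w U := by
    refine rootedVal_le_connVal ⟨v, hv⟩ hn (hU.rooted hSne) (fun y hy hyr hyc => ?_) (ih S hS)
    exfalso
    apply hyc
    -- Claiming v is possible only if C is all of the rest, since the roots lie in C. As long as v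
    -- remains, it is adjacent to all roots and ties the components together.
    by_cases hyv : y = v
    · subst hyv
      have : (U.erase y : Set V) = C := by
        by_contra hne
        obtain ⟨s, hs, hsS⟩ := hyr _ hcl.diff
          (Set.sdiff_nonempty.2 fun h => hne (h.antisymm hcl.subset))
        exact hs.2 ((hSC s).1 ⟨Finset.mem_of_mem_erase hs.1, hsS⟩).1
      rwa [this]
    · refine hyr.conn_of_adj (z := v) (by simp [hv, Ne.symm hyv]) fun s hs hsS => ?_
      exact ((hSC s).1 ⟨Finset.mem_of_mem_erase hs, hsS⟩).2.symm
  linarith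

/-- A surviving vertex of Q would be adjacent to all remaining roots and hence connect everything.
So a disconnecting move has to remove the whole of Q, which must then be a single vertex. -/
theorem IsSplit.eq_of_not_conn {B C U : Finset V} {P Q S : Set V} (h : IsSplit G B C P Q)
    (hUeq : U = B ∪ C) (hP : ∀ x ∈ U, x ∈ S → x ∈ P) {y : V}
    (hyr : Rooted G S (U.erase y : Finset V)) (hyc : ¬ Conn G (U.erase y : Finset V)) {q : V}
    (hq : q ∈ Q) : q = y := by
  by_contra hqy
  have hqC := h.right_subset hq
  refine hyc (hyr.conn_of_adj (z := q) ?_ fun s hs hsS => ?_)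
  · subst hUeq
    exact Finset.mem_erase.2 ⟨hqy, Finset.mem_union_right _ hqC⟩
  · have hsP := hP s (Finset.mem_of_mem_erase hs) hsS
    exact (h.adj_iff s (h.left_subset hsP) q hqC).2 ⟨hsP, hq⟩

/-- The even case. -/
theorem IsRootFamily.comparison_even (hF : IsRootFamily G F) {n : ℕ} (hn : Even n)
    (ih : ∀ S ∈ F, Comparison G w S (n - 1)) {U : Finset V} (hcard : U.card = n)
    (hU : Conn G (U : Set V)) {S : Set V} (hS : S ∈ F) (hne : (U ∩ S : Set V).Nonempty) :
    0 ≤ connVal G w U + rootedVal G w S U := by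
  have single : ∀ v, (U ∩ S : Set V) = {v} → 0 ≤ connVal G w U + rootedVal G w S U := by
    intro v hv
    have hvU : v ∈ (U ∩ S : Set V) := hv ▸ rfl
    have hcongr : rootedVal G w S U = rootedVal G w {v} U :=
      rootedVal_congr fun x hx => ⟨fun h => hv ▸ ⟨hx, h⟩, fun h => h ▸ hvU.2⟩
    rw [hcongr]
    exact hF.comparison_singleton hn ih hcard hU hvU.1
  rcases hne.exists_eq_singleton_or_nontrivial with ⟨v, hv⟩ | hnt
  · exact single v hv
  obtain ⟨B, C, S', hS', hUeq, hCne, hsplit⟩ := hF.exists_split U hU S hS hnt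
  have hSroot : Rooted G (U ∩ S) (U : Set V) := hU.rooted (by
    obtain ⟨x, hx⟩ := hne
    exact ⟨x, hx.1, hx⟩)
  obtain ⟨p, hp⟩ := hne
  have h1 := hsplit.rootedVal_add_nonneg (w := w) (by rwa [← hUeq]) ⟨p, hsplit.left_subset hp⟩ hCne
    (by rwa [← hUeq, hcard])
  rw [← hUeq] at h1
  have hcongr : ∀ S : Set V, rootedVal G w (U ∩ S) U = rootedVal G w S U :=
    fun S => rootedVal_congr fun x hx => ⟨fun h => h.2, fun h => ⟨hx, h⟩⟩
  rw [hcongr, hcongr] at h1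
  have hS'ne : (U ∩ S' : Set V).Nonempty := by
    obtain ⟨-, hr, -⟩ := (hsplit.rooted_iff subset_rfl subset_rfl).1 (by rwa [← hUeq])
    exact (hr.nonempty hCne).mono Set.inter_subset_right
  have h2 : rootedVal G w S' U ≤ connVal G w U := by
    refine rootedVal_le_connVal ⟨p, hp.1⟩ (hcard ▸ hn) (hU.rooted hS'ne)
      (fun y hy hyr hyc => ?_) (hcard ▸ ih S' hS')
    -- With the parts exchanged, a disconnecting move in the game rooted at `S'` would have to
    -- remove all of `U ∩ S`, which has at least two vertices.
    have := fun q hq => hsplit.symm.eq_of_not_conn (hUeq.trans (Finset.union_comm _ _))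
      (fun x hx hxS => ⟨hx, hxS⟩) hyr hyc (q := q) hq
    obtain ⟨a, ha, b, hb, hab⟩ := hnt
    exact absurd ((this a ha).trans (this b hb).symm) hab
  linarith

/-- A move in the rooted game that disconnects the rest uncovers the neighbourhood of a vertex. -/
theorem IsRootFamily.eq_neighborSet (hF : IsRootFamily G F) {U : Finset V}
    (hU : Conn G (U : Set V)) {S : Set V} (hS : S ∈ F) {y : V}
    (hyr : Rooted G S (U.erase y : Finset V)) (hyc : ¬ Conn G (U.erase y : Finset V)) :
    ∀ x ∈ U.erase y, x ∈ S ↔ x ∈ G.neighborSet y := by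
  have hne : (U.erase y).Nonempty := by
    rw [Finset.nonempty_iff_ne_empty]
    intro h
    rw [h] at hyc
    exact hyc fun A hA hA' => by
      have := hA'.mono hA.subset
      simp at this
  have hnt : (U ∩ S : Set V).Nontrivial := by
    obtain ⟨a, ha, haS⟩ := hyr.nonempty hne
    refine Set.not_subsingleton_iff.1 fun hsub => hyc ?_
    refine (hyr.congr (S' := {a}) fun x hx hxS => ?_).conn
    exact hsub ⟨Finset.mem_of_mem_erase hx, hxS⟩ ⟨Finset.mem_of_mem_erase ha, haS⟩
  obtain ⟨B, C, S', hS', hUeq, hCne, hsplit⟩ := hF.exists_split U hU S hS hnt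
  have hQ : ∀ q ∈ (U ∩ S' : Set V), q = y := fun q hq =>
    hsplit.eq_of_not_conn hUeq (fun x hx hxS => ⟨hx, hxS⟩) hyr hyc hq
  have hSroot : Rooted G (U ∩ S) (U : Set V) := hU.rooted (by
    obtain ⟨x, hx⟩ := hnt.nonempty
    exact ⟨x, hx.1, hx⟩)
  obtain ⟨-, hQC, -⟩ := (hsplit.rooted_iff subset_rfl subset_rfl).1 (by rwa [← hUeq])
  have hyQ : y ∈ (U ∩ S' : Set V) := by
    obtain ⟨q, -, hq⟩ := hQC.nonempty hCne
    rwa [← hQ q hq]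
  have hyC : y ∈ C := hsplit.right_subset hyQ
  -- With y, the only link between the parts is gone; any other vertex of C would lie in a rootless
  -- component. Hence C consists of y alone.
  have hCy : ∀ c ∈ C, c = y := by
    by_contra! hcon
    obtain ⟨c, hc, hcy⟩ := hcon
    have hcl : ClosedIn G (U.erase y : Finset V) (C.erase y : Finset V) := by
      refine ⟨fun a ha => ?_, fun a ha b hb hab => ?_⟩
      · rw [Finset.mem_coe, Finset.mem_erase] at ha ⊢
        exact ⟨ha.1, hUeq ▸ Finset.mem_union_right _ ha.2⟩
      · rw [Finset.mem_coe, Finset.mem_erase] at ha hb ⊢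
        refine ⟨hb.1, (Finset.mem_union.1 (hUeq ▸ hb.2)).resolve_left fun hbB => ?_⟩
        exact ha.1 (hQ a ((hsplit.adj_iff b hbB a ha.2).1 hab.symm).2)
    obtain ⟨s, hs, hsS⟩ := hyr _ hcl ⟨c, by simp [hc, hcy]⟩
    have hsC := Finset.mem_of_mem_erase hs
    exact hsplit.symm.notMem_right hsC
      (hsplit.left_subset ⟨hUeq ▸ Finset.mem_union_right _ hsC, hsS⟩)
  intro x hx
  rw [Finset.mem_erase] at hx
  have hxB : x ∈ B := (Finset.mem_union.1 (hUeq ▸ hx.2)).resolve_right fun h => hx.1 (hCy x h)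
  rw [SimpleGraph.mem_neighborSet, G.adj_comm, hsplit.adj_iff x hxB y hyC]
  exact ⟨fun h => ⟨⟨hx.2, h⟩, hyQ⟩, fun h => h.1.2⟩

/-- Odd sets use the even statement for one vertex less, and even sets the odd statement for one
vertex less. In the odd case, an optimal unrooted move x is turned into a bound for the rooted game.
-/
theorem IsRootFamily.comparison (hF : IsRootFamily G F) (n : ℕ) :
    ∀ S ∈ F, Comparison G w S n := by
  induction n using Nat.strong_induction_on with
  | _ n ih =>
  intro S hS U hcard hU hne
  have hUne : U.Nonempty := hne.imp fun x hx => hx.1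
  have hpos : 0 < n := hcard ▸ Finset.card_pos.2 hUne
  refine ⟨fun hodd => ?_, fun heven => hF.comparison_even heven (ih (n - 1) (by omega)) hcard hU
    hS hne⟩
  obtain ⟨x, hx, hxc, hval⟩ := exists_val_eq (L := fun Z : Finset V => Conn G (Z : Set V)) (w := w)
    (hU.exists_erase hUne)
  have hcardx := Finset.card_erase_add_one hx
  have hevenx : Even (U.erase x).card := by
    rw [← hcard, ← hcardx] at hodd
    simpa [parity_simps] using hodd
  rw [connVal, hval]
  by_cases hsingle : (U ∩ S : Set V) ⊆ {x}
  · have hxS : x ∈ S := by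
      obtain ⟨s, hs⟩ := hne
      obtain rfl : s = x := hsingle hs
      exact hs.2
    have hxroot : Rooted G {x} (U : Set V) := hU.rooted ⟨x, hx, rfl⟩
    have hcongr : rootedVal G w S U = rootedVal G w {x} U :=
      rootedVal_congr fun z hz => ⟨fun h => hsingle ⟨hz, h⟩, fun h => by rwa [h]⟩
    have hins : insert x (U.erase x) = U := Finset.insert_erase hx
    have hnr : Rooted G (G.neighborSet x) (U.erase x : Finset V) :=
      (rooted_insert_iff (Finset.notMem_erase x U)).1 (by rwa [hins])
    have h1 := rootedVal_insert (w := w) (Finset.notMem_erase x U) hnr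
    rw [hins, hevenx.neg_one_pow, one_mul] at h1
    rw [hcongr, h1]
    have h2 : 0 ≤ connVal G w (U.erase x) + rootedVal G w (G.neighborSet x) (U.erase x) := by
      rcases (U.erase x).eq_empty_or_nonempty with hemp | hne'
      · have h3 : connVal G w ∅ = 0 := val_empty
        have h4 : rootedVal G w (G.neighborSet x) ∅ = 0 := val_empty
        rw [hemp, h3, h4]
        simp
      · obtain ⟨S', hS', hSC⟩ := hF.exists_eq_neighbors U (U.erase x) x hx hU hxc hne' .refl
        have hcongr' : rootedVal G w (G.neighborSet x) (U.erase x) =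
            rootedVal G w S' (U.erase x) := by
          refine rootedVal_congr fun z hz => ?_
          exact ⟨fun h => ((hSC z).2 ⟨hz, h⟩).2,
            fun h => ((hSC z).1 ⟨Finset.mem_of_mem_erase hz, h⟩).2⟩
        rw [hcongr']
        refine (ih (U.erase x).card (by omega) S' hS' _ rfl hxc ?_).2 hevenx
        obtain ⟨z, hz, hzx⟩ := hnr.nonempty hne'
        exact ⟨z, hz, ((hSC z).2 ⟨hz, hzx⟩).2⟩
    linarith
  · have hne' : ((U.erase x : Finset V) ∩ S : Set V).Nonempty := by
      obtain ⟨s, hs, hsx⟩ := Set.not_subset.1 hsingle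
      exact ⟨s, Finset.mem_erase.2 ⟨hsx, hs.1⟩, hs.2⟩
    have hxr : Rooted G S (U.erase x : Finset V) := hxc.rooted hne'
    have h1 : w x - rootedVal G w S (U.erase x) ≤ rootedVal G w S U := le_val hx hxr
    have h2 : rootedVal G w S (U.erase x) ≤ connVal G w (U.erase x) := by
      -- If x is also a rooted move, the opponent's reply y matters only when it disconnects the
      -- rest. Then the roots become the neighbours of y, and the value after y differs from that of
      -- the game rooted at y only by the weight of y. The even case for the single root y applies.
      refine rootedVal_le_connVal (hne'.imp fun z hz => hz.1) hevenx hxr (fun y hy hyr hyc => ?_)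
        (ih _ (by omega) S hS)
      have hN := hF.eq_neighborSet hxc hS hyr hyc
      have hcardy := Finset.card_erase_add_one hy
      have hoddy : Odd ((U.erase x).erase y).card := by
        rw [← hcardy] at hevenx
        simpa [parity_simps] using hevenx
      have hnr : Rooted G (G.neighborSet y) ((U.erase x).erase y : Finset V) :=
        hyr.congr fun z hz => (hN z hz).1
      have h3 := rootedVal_insert (w := w) (Finset.notMem_erase y (U.erase x)) hnr
      rw [Finset.insert_erase hy, hoddy.neg_one_pow] at h3
      have h4 : 0 ≤ connVal G w (U.erase x) + rootedVal G w {y} (U.erase x) :=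
        hF.comparison_singleton hevenx (ih _ (by omega)) rfl hxc hy
      rw [rootedVal_congr hN]
      linarith
    linarith

end Induction

/-! ### Connected sets and acyclic graphs -/

theorem Conn.image {V V' : Type*} {G : SimpleGraph V} {K : SimpleGraph V'} {X : Set V} (f : V → V')
    (hf : ∀ x ∈ X, ∀ y ∈ X, G.Adj x y → f x = f y ∨ K.Adj (f x) (f y)) (h : Conn G X) :
    Conn K (f '' X) := by
  rintro A hA ⟨a, ha⟩
  obtain ⟨x, hx, rfl⟩ := hA.subset ha
  have := h (X ∩ f ⁻¹' A) ⟨Set.inter_subset_left, fun y hy z hz hyz => ⟨hz, ?_⟩⟩ ⟨x, hx, ha⟩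
  · refine hA.subset.antisymm ?_
    rintro _ ⟨y, hy, rfl⟩
    exact (this.superset hy).2
  · rcases hf y hy.1 z hz hyz with heq | hadj
    · rw [Set.mem_preimage, ← heq]
      exact hy.2
    · exact hA.mem_of_adj _ hy.2 _ ⟨z, hz, rfl⟩ hadj

/-- In an acyclic graph, a vertex has at most one neighbour in a connected set avoiding it. -/
theorem Conn.eq_of_adj {V : Type*} {K : SimpleGraph V} (hK : K.IsAcyclic) {D : Set V}
    (hD : Conn K D) {i j j' : V} (hi : i ∉ D) (hj : j ∈ D) (hj' : j' ∈ D) (hij : K.Adj i j)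
    (hij' : K.Adj i j') : j = j' := by
  by_contra hne
  have hbridge := (SimpleGraph.isAcyclic_iff_forall_adj_isBridge.1 hK) hij
  rw [SimpleGraph.isBridge_iff] at hbridge
  set K' := K \ SimpleGraph.fromEdgeSet {s(i, j)} with hK'
  have hadj : ∀ x y, K.Adj x y → s(x, y) ≠ s(i, j) → K'.Adj x y := by
    intro x y hxy hne
    rw [hK', SimpleGraph.sdiff_adj, SimpleGraph.fromEdgeSet_adj]
    exact ⟨hxy, fun h => hne h.1⟩
  -- Walking from i to j' and on inside D never uses the edge ij, as i is outside D. Reaching j in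
  -- this way contradicts that ij is a bridge.
  have hcl : ClosedIn K D {z | z ∈ D ∧ K'.Reachable i z} := by
    refine ⟨fun _ hz => hz.1, fun a ha b hb hab => ⟨hb, ha.2.trans (hadj a b hab ?_).reachable⟩⟩
    intro heq
    have : i ∈ s(a, b) := heq ▸ Sym2.mem_mk_left i j
    rcases Sym2.mem_iff.1 this with rfl | rfl
    · exact hi ha.1
    · exact hi hb
  have := hD _ hcl ⟨j', hj', (hadj i j' hij' fun heq => hne ?_).reachable⟩
  · exact hbridge (this.superset hj).2
  · exact (Sym2.congr_right.1 heq).symm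

/-! ### Root sets of `H`-trees -/

/-- The root sets: single vertices, classes, and neighbourhoods of classes. -/
def rootSets {ι W V : Type*} (H : SimpleGraph W) (part : W → ι) (hub : W → V) : Set (Set V) :=
  {S | (∃ v, S = {v}) ∨ (∃ i, S = hub '' (part ⁻¹' {i})) ∨
    ∃ i, S = hub '' nbhd H (part ⁻¹' {i})}

section HTree

variable {ι W V : Type*} {T : SimpleGraph ι} {H : SimpleGraph W} {part : W → ι}
  {G : SimpleGraph V} {hub : W → V} {base : V → W}

theorem IsBlowUp.mem_nbhd_iff (hH : IsBlowUp T H part) {i : ι} {b : W} :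
    b ∈ nbhd H (part ⁻¹' {i}) ↔ T.Adj i (part b) := by
  constructor
  · rintro ⟨a, rfl, hba⟩
    exact ((hH.adj_iff _ _).1 hba).symm
  · intro h
    obtain ⟨a, ha⟩ := hH.nonempty i
    obtain rfl : part a = i := ha
    exact ⟨a, rfl, (hH.adj_iff _ _).2 h.symm⟩

theorem IsHTree.adj_hub_iff (hG : IsHTree H G hub base) {a b : W} :
    G.Adj (hub a) (hub b) ↔ H.Adj a b := by
  by_cases hab : a = b
  · subst hab
    simp
  · rw [hG.adj_iff _ _ (by rwa [hG.base_hub, hG.base_hub]), hG.base_hub, hG.base_hub]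
    simp

/-- A connected set that meets the tree at `a` and is not contained in it contains the vertex `a`
of `H` and one of its neighbours. -/
theorem IsHTree.exists_adj_hub (hG : IsHTree H G hub base) {X : Set V} (hX : Conn G X) {z z' : V}
    (hz : z ∈ X) (hz' : z' ∈ X) (hne : base z' ≠ base z) :
    hub (base z) ∈ X ∧ ∃ b, H.Adj (base z) b ∧ hub b ∈ X := by
  by_contra hcon
  have := hX {x | x ∈ X ∧ base x = base z} ⟨fun _ hx => hx.1, fun x hx y hy hxy => ⟨hy, ?_⟩⟩
    ⟨z, hz, rfl⟩
  · exact hne (this.superset hz').2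
  · by_contra hyz
    have hxb := hx.2
    obtain ⟨h1, h2, h3⟩ := (hG.adj_iff x y (by rw [hxb]; exact Ne.symm hyz)).1 hxy
    rw [hxb] at h1 h3
    exact hcon ⟨h1 ▸ hx.1, base y, h3, h2 ▸ hy⟩

/-- The part of a connected set in one of the trees is connected. -/
theorem IsHTree.conn_inter (hG : IsHTree H G hub base) {X : Set V} (hX : Conn G X) (a : W) :
    Conn G {x | x ∈ X ∧ base x = a} := by
  -- Edges leave the tree only through its hub, so a union of components of the part that misses the
  -- hub is already one of X.
  have key : ∀ A, ClosedIn G {x | x ∈ X ∧ base x = a} A → A.Nonempty → hub a ∉ A → A = X := by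
    intro A hA hne hhub
    refine hX A ⟨fun x hx => (hA.subset hx).1, fun x hx y hy hxy => ?_⟩ hne
    have hxb := (hA.subset hx).2
    by_cases hya : base y = a
    · exact hA.mem_of_adj x hx y ⟨hy, hya⟩ hxy
    · have := ((hG.adj_iff x y (by rw [hxb]; exact Ne.symm hya)).1 hxy).1
      rw [hxb] at this
      exact absurd (this ▸ hx) hhub
  intro A hA hne
  by_cases hhub : hub a ∈ A
  · by_contra hAX
    have hne' := Set.sdiff_nonempty.2 fun h => hAX (hA.subset.antisymm h)
    have := key _ hA.diff hne' fun h => h.2 hhub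
    exact (this.superset (hA.subset hhub).1).2 hhub
  · exact hA.subset.antisymm fun x hx => (key A hA hne hhub).superset hx.1

/-- Two neighbours in the tree of v would create a cycle in this tree. If the second lies elsewhere,
v must be the hub of its tree; but X then leaves that tree and contains the hub, whereas v is not in
X. -/
theorem IsHTree.eq_of_adj (hG : IsHTree H G hub base) {X : Set V} (hX : Conn G X) {v n n' : V}
    (hv : v ∉ X) (hn : n ∈ X) (hn' : n' ∈ X) (hvn : G.Adj v n) (hvn' : G.Adj v n')
    (hb : base n = base v) : n' = n := by
  by_cases hb' : base n' = base v
  · have hD := hG.conn_inter hX (base v)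
    have hD' : Conn (G.induce {x | base x = base v}) {x | (x : V) ∈ X} := by
      rintro A hA ⟨⟨a, ha⟩, haA⟩
      have h1 := hD (Subtype.val '' A) ⟨?_, ?_⟩ ⟨a, _, haA, rfl⟩
      · refine hA.subset.antisymm fun x hx => ?_
        obtain ⟨y, hy, hyx⟩ := h1.superset ⟨hx, x.2⟩
        rwa [← Subtype.ext hyx]
      · rintro _ ⟨x, hx, rfl⟩
        exact ⟨hA.subset hx, x.2⟩
      · rintro _ ⟨x, hx, rfl⟩ y hy hxy
        exact ⟨⟨y, hy.2⟩, hA.mem_of_adj x hx ⟨y, hy.2⟩ hy.1 hxy, rfl⟩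
    have := hD'.eq_of_adj (hG.isTree (base v)).isAcyclic (i := ⟨v, rfl⟩) (j := ⟨n', hb'⟩)
      (j' := ⟨n, hb⟩) hv hn' hn hvn' hvn
    exact congrArg Subtype.val this
  · have h1 := (hG.exists_adj_hub hX hn hn' (by rwa [hb])).1
    have h2 := ((hG.adj_iff v n' (Ne.symm hb')).1 hvn').1
    rw [hb, ← h2] at h1
    exact absurd h1 hv

/-- In a connected set without vertices of the class `i` of `H`, at most one class next to the class
`i` is represented. -/
theorem IsHTree.part_eq (hT : T.IsAcyclic) (hH : IsBlowUp T H part) (hG : IsHTree H G hub base)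
    {X : Set V} (hX : Conn G X) {i : ι} (hi : ∀ a, part a = i → hub a ∉ X) {b c : W}
    (hb : hub b ∈ X) (hc : hub c ∈ X) (hib : T.Adj i (part b)) (hic : T.Adj i (part c)) :
    part b = part c := by
  -- Contracting every tree and every class maps X to a connected set of `T` that avoids i, so
  -- acyclicity of `T` leaves i only one neighbour in it.
  have hD : Conn T ((fun z => part (base z)) '' X) := by
    refine hX.image _ fun x _ y _ hxy => ?_
    by_cases hne : base x = base y
    · exact Or.inl (congrArg part hne)
    · exact Or.inr ((hH.adj_iff _ _).1 ((hG.adj_iff x y hne).1 hxy).2.2)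
  refine hD.eq_of_adj hT (i := i) ?_ ⟨hub b, hb, by simp only [hG.base_hub]⟩
    ⟨hub c, hc, by simp only [hG.base_hub]⟩ hib hic
  rintro ⟨z, hz, hzi⟩
  refine hi (base z) hzi (hG.exists_adj_hub hX hz hb ?_).1
  rw [hG.base_hub]
  intro h
  rw [h] at hib
  exact hib.ne hzi.symm

/-- The split of an `H`-tree into the trees at the vertices of a class and the rest. -/
theorem IsHTree.isSplit (hH : IsBlowUp T H part) (hG : IsHTree H G hub base) [DecidableEq ι]
    (U : Finset V) (i : ι) :
    IsSplit G {x ∈ U | part (base x) = i} {x ∈ U | part (base x) ≠ i}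
      (U ∩ hub '' (part ⁻¹' {i})) (U ∩ hub '' nbhd H (part ⁻¹' {i})) where
  disjoint := Finset.disjoint_filter_filter_not U U _
  left_subset := by
    rintro _ ⟨hx, a, ha, rfl⟩
    rw [Finset.mem_coe, Finset.mem_filter, hG.base_hub]
    exact ⟨hx, ha⟩
  right_subset := by
    rintro _ ⟨hx, a, ha, rfl⟩
    rw [Finset.mem_coe, Finset.mem_filter, hG.base_hub]
    exact ⟨hx, (hH.mem_nbhd_iff.1 ha).ne'⟩
  adj_iff := by
    intro b hb c hc
    rw [Finset.mem_filter] at hb hc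
    constructor
    · intro hbc
      obtain ⟨h1, h2, h3⟩ := (hG.adj_iff b c fun h => hc.2 (h ▸ hb.2)).1 hbc
      refine ⟨⟨hb.1, base b, hb.2, h1.symm⟩, hc.1, base c, ?_, h2.symm⟩
      rw [hH.mem_nbhd_iff, ← hb.2]
      exact (hH.adj_iff _ _).1 h3
    · rintro ⟨⟨-, x, hx, rfl⟩, -, y, hy, rfl⟩
      rw [hG.adj_hub_iff, hH.adj_iff, show part x = i from hx]
      exact hH.mem_nbhd_iff.1 hy

/-! ### The root sets of an `H`-tree form a root family -/

variable [DecidableEq V]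

/-- A neighbour of v in its own tree is the only neighbour in C. Otherwise v is a hub. A twin of v
in U then lies in C and pulls all neighbours of the class into C; without a twin, all neighbours in
C come from one class, and they form a single vertex or all of that class remaining in U. -/
theorem IsHTree.exists_eq_neighbors (hT : T.IsAcyclic) (hH : IsBlowUp T H part)
    (hG : IsHTree H G hub base) {U C : Finset V} {v : V} (hv : v ∈ U) (hU : Conn G (U : Set V))
    (hC : Conn G (C : Set V)) (hCne : C.Nonempty)
    (hcl : ClosedIn G (U.erase v : Finset V) (C : Set V)) :
    ∃ S ∈ rootSets H part hub, ∀ x, x ∈ U ∧ x ∈ S ↔ x ∈ C ∧ G.Adj v x := by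
  have hCU : ∀ x ∈ C, x ∈ U := fun x hx => Finset.mem_of_mem_erase (hcl.subset hx)
  have hvC : v ∉ C := fun h => Finset.notMem_erase v U (hcl.subset h)
  have single : ∀ n ∈ C, G.Adj v n → (∀ n' ∈ C, G.Adj v n' → n' = n) →
      ∃ S ∈ rootSets H part hub, ∀ x, x ∈ U ∧ x ∈ S ↔ x ∈ C ∧ G.Adj v x := by
    intro n hn hvn huniq
    refine ⟨{n}, Or.inl ⟨n, rfl⟩, fun x => ⟨?_, fun h => ⟨hCU x h.1, huniq x h.1 h.2⟩⟩⟩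
    rintro ⟨-, rfl⟩
    exact ⟨hn, hvn⟩
  obtain ⟨n, hn, hvn⟩ : ∃ n ∈ C, G.Adj v n := by
    by_contra! hcon
    have := hU C ⟨hCU, fun a ha b hb hab => hcl.mem_of_adj a ha b (Finset.mem_erase.2 ⟨?_, hb⟩) hab⟩
      hCne
    · exact hvC (this.superset hv)
    · rintro rfl
      exact hcon a ha hab.symm
  by_cases htree : ∃ n ∈ C, G.Adj v n ∧ base n = base v
  · obtain ⟨n, hn, hvn, hb⟩ := htree
    exact single n hn hvn fun n' hn' hvn' => hG.eq_of_adj hC hvC hn hn' hvn hvn' hb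
  push Not at htree
  have hnbr : ∀ x ∈ C, G.Adj v x → v = hub (base v) ∧ x = hub (base x) ∧ H.Adj (base v) (base x) :=
    fun x hx hvx => (hG.adj_iff v x (Ne.symm (htree x hx hvx))).1 hvx
  obtain ⟨hvh, hnh, hab⟩ := hnbr n hn hvn
  set a := base v with ha
  have hadjv : ∀ b, T.Adj (part a) (part b) → G.Adj v (hub b) := fun b hb => by
    rw [hvh, hG.adj_hub_iff, hH.adj_iff]
    exact hb
  have hne_v : ∀ b, T.Adj (part a) (part b) → hub b ≠ v := fun b hb h => (hadjv b hb).ne h.symm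
  by_cases hother : ∃ a', a' ≠ a ∧ part a' = part a ∧ hub a' ∈ U
  · obtain ⟨a', hne, hpa', ha'U⟩ := hother
    have hadj' : ∀ b, T.Adj (part a) (part b) → G.Adj (hub a') (hub b) := fun b hb => by
      rw [hG.adj_hub_iff, hH.adj_iff, hpa']
      exact hb
    have ha'v : hub a' ≠ v := fun h => hne (by rw [ha, ← h, hG.base_hub])
    have ha'C : hub a' ∈ C := by
      refine hcl.mem_of_adj n hn _ (Finset.mem_erase.2 ⟨ha'v, ha'U⟩) ?_
      rw [hnh]
      exact (hadj' _ ((hH.adj_iff _ _).1 hab)).symm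
    refine ⟨_, Or.inr (Or.inr ⟨part a, rfl⟩), fun x => ⟨?_, fun hx => ⟨hCU x hx.1, ?_⟩⟩⟩
    · rintro ⟨hxU, b, hb, rfl⟩
      rw [hH.mem_nbhd_iff] at hb
      exact ⟨hcl.mem_of_adj _ ha'C _ (Finset.mem_erase.2 ⟨hne_v b hb, hxU⟩) (hadj' b hb), hadjv b hb⟩
    · obtain ⟨-, h2, h3⟩ := hnbr x hx.1 hx.2
      exact ⟨base x, hH.mem_nbhd_iff.2 ((hH.adj_iff _ _).1 h3), h2.symm⟩
  · push Not at hother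
    have hi : ∀ b, part b = part a → hub b ∉ (C : Set V) := by
      intro b hb hbC
      by_cases hba : b = a
      · rw [hba, ← hvh] at hbC
        exact hvC hbC
      · exact hother b hba hb (hCU _ hbC)
    have hpart : ∀ x ∈ C, G.Adj v x → part (base x) = part (base n) := by
      intro x hx hvx
      obtain ⟨-, h2, h3⟩ := hnbr x hx hvx
      exact hG.part_eq hT hH hC hi (h2 ▸ hx) (hnh ▸ hn) ((hH.adj_iff _ _).1 h3)
        ((hH.adj_iff _ _).1 hab)
    by_cases hsingle : ∀ n' ∈ C, G.Adj v n' → n' = n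
    · exact single n hn hvn hsingle
    push Not at hsingle
    obtain ⟨m, hm, hvm, hmn⟩ := hsingle
    have hmh := (hnbr m hm hvm).2.1
    -- Two neighbours of v in C are hubs of different trees, so C contains a hub adjacent to n. It
    -- is adjacent to the whole class of n and brings every remaining vertex of this class into C.
    obtain ⟨-, b', hbb', hb'C⟩ := hG.exists_adj_hub hC hn hm fun h => hmn (by rw [hmh, h, ← hnh])
    have hij := (hH.adj_iff _ _).1 hab
    refine ⟨_, Or.inr (Or.inl ⟨part (base n), rfl⟩), fun x => ⟨?_, fun hx => ⟨hCU x hx.1, ?_⟩⟩⟩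
    · rintro ⟨hxU, b, hb, rfl⟩
      replace hb : part b = part (base n) := hb
      have hib : T.Adj (part a) (part b) := hb ▸ hij
      refine ⟨hcl.mem_of_adj _ hb'C _ (Finset.mem_erase.2 ⟨hne_v b hib, hxU⟩) ?_, hadjv b hib⟩
      rw [hG.adj_hub_iff, hH.adj_iff, hb]
      exact ((hH.adj_iff _ _).1 hbb').symm
    · exact ⟨base x, hpart x hx.1 hx.2, (hnbr x hx.1 hx.2).2.1.symm⟩

/-- A class is split from the rest by taking all trees attached to it; a second vertex of the class
in the connected set forces a vertex beyond these trees. A neighbourhood uses the same split with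
the parts exchanged, provided that the class itself is still present. -/
theorem IsHTree.exists_split (hT : T.IsAcyclic) (hH : IsBlowUp T H part)
    (hG : IsHTree H G hub base) {U : Finset V} (hU : Conn G (U : Set V)) {S : Set V}
    (hS : S ∈ rootSets H part hub) (hnt : (U ∩ S : Set V).Nontrivial) :
    ∃ B C : Finset V, ∃ S' ∈ rootSets H part hub, U = B ∪ C ∧ C.Nonempty ∧
      IsSplit G B C (U ∩ S) (U ∩ S') := by
  classical
  have hclass : ∀ i, (U ∩ hub '' (part ⁻¹' {i}) : Set V).Nontrivial →
      ∃ B C : Finset V, ∃ S' ∈ rootSets H part hub, U = B ∪ C ∧ C.Nonempty ∧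
        IsSplit G B C (U ∩ hub '' (part ⁻¹' {i})) (U ∩ S') := by
    rintro i ⟨_, ⟨hxU, a, ha, rfl⟩, _, ⟨hyU, a', ha', rfl⟩, hne⟩
    refine ⟨_, _, _, Or.inr (Or.inr ⟨i, rfl⟩), (Finset.filter_union_filter_not_eq _ U).symm, ?_,
      hG.isSplit hH U i⟩
    obtain ⟨-, b, hab, hbU⟩ := hG.exists_adj_hub hU hxU hyU (by
      rw [hG.base_hub, hG.base_hub]
      rintro rfl
      exact hne rfl)
    rw [hG.base_hub, hH.adj_iff, show part a = i from ha] at hab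
    exact ⟨hub b, Finset.mem_filter.2 ⟨hbU, by rw [hG.base_hub]; exact hab.ne'⟩⟩
  rcases hS with ⟨v, rfl⟩ | ⟨i, rfl⟩ | ⟨i, rfl⟩
  · exact absurd (Set.subsingleton_singleton.anti Set.inter_subset_right)
      (Set.not_subsingleton_iff.2 hnt)
  · exact hclass i hnt
  · by_cases hi : ∃ a, part a = i ∧ hub a ∈ U
    · obtain ⟨a, ha, haU⟩ := hi
      refine ⟨_, _, _, Or.inr (Or.inl ⟨i, rfl⟩), ?_, ⟨hub a, ?_⟩, (hG.isSplit hH U i).symm⟩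
      · rw [Finset.union_comm]
        exact (Finset.filter_union_filter_not_eq _ U).symm
      · rw [Finset.mem_filter, hG.base_hub]
        exact ⟨haU, ha⟩
    · push Not at hi
      obtain ⟨_, hxU, b, hb, rfl⟩ := hnt.nonempty
      have hib := hH.mem_nbhd_iff.1 hb
      -- Once class i is gone, acyclicity of `T` leaves only one class of its neighbourhood in U,
      -- and the case of a class applies.
      have heq : (U ∩ hub '' nbhd H (part ⁻¹' {i}) : Set V) =
          (U ∩ hub '' (part ⁻¹' {part b}) : Set V) := by
        ext x
        constructor
        · rintro ⟨hx, c, hc, rfl⟩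
          exact ⟨hx, c, hG.part_eq hT hH hU hi hx hxU (hH.mem_nbhd_iff.1 hc) hib, rfl⟩
        · rintro ⟨hx, c, hc, rfl⟩
          refine ⟨hx, c, hH.mem_nbhd_iff.2 ?_, rfl⟩
          rwa [show part c = part b from hc]
      rw [heq] at hnt ⊢
      exact hclass _ hnt

theorem IsHTree.isRootFamily (hT : T.IsAcyclic) (hH : IsBlowUp T H part)
    (hG : IsHTree H G hub base) : IsRootFamily G (rootSets H part hub) where
  exists_eq_neighbors _ _ _ hv hU hC hCne hcl := hG.exists_eq_neighbors hT hH hv hU hC hCne hcl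
  exists_split _ hU _ hS hnt := hG.exists_split hT hH hU hS hnt

end HTree

/-- With total weight W, the scores are (W ± c)/2 and (W ± r)/2, so both inequalities amount to 0 ≤
c + r, the even comparison on the whole vertex set. -/
theorem IsRootFamily.score_le {V : Type*} [Fintype V] [DecidableEq V] {G : SimpleGraph V}
    {F : Set (Set V)} (hF : IsRootFamily G F) (hconn : G.Connected)
    (heven : Even (Fintype.card V)) (w : V → ℝ≥0) {S : Set V} (hS : S ∈ F) (hne : S.Nonempty) :
    R G w S .one ≥ N G w .two ∧ R G w S .two ≤ N G w .one := by
  have hU : Conn G ((Finset.univ : Finset V) : Set V) := by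
    rw [Finset.coe_univ]
    rintro A hA ⟨a, ha⟩
    refine Set.eq_univ_of_forall fun b => ?_
    obtain ⟨p⟩ := hconn.preconnected a b
    induction p with
    | nil => exact ha
    | cons hadj _ ih => exact ih (hA.mem_of_adj _ ha _ trivial hadj)
  have hSU : ((Finset.univ : Finset V) ∩ S : Set V).Nonempty := by simpa using hne
  have hcmp := (hF.comparison (w := fun v => (w v : ℝ)) _ S hS Finset.univ rfl hU hSU).2 heven
  have hN := score_eq (feasible := feasibleN G) (L := fun Z : Finset V => Conn G (Z : Set V))
    (fun _ _ => preconnected_induce_iff) (fun _ h hne => h.exists_erase hne) w hU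
  have hR := score_eq (feasible := feasibleR G S) (L := fun Z : Finset V => Rooted G S Z)
    (fun _ _ => forall_component_iff) (fun _ h hne => h.exists_erase hne) w (hU.rooted hSU)
  constructor
  · refine NNReal.coe_le_coe.1 ?_
    change ((score (feasibleN G) w Finset.univ).2 : ℝ) ≤ (score (feasibleR G S) w Finset.univ).1
    linarith [hN.2, hR.1]
  · refine NNReal.coe_le_coe.1 ?_
    change ((score (feasibleR G S) w Finset.univ).2 : ℝ) ≤ (score (feasibleN G) w Finset.univ).1
    linarith [hN.1, hR.2]

end GraphGrabbing

theorem lemma4 {ι W V : Type*} [Fintype V] [DecidableEq V]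
    (T : SimpleGraph ι) (hT : T.IsTree)
    (H : SimpleGraph W) (part : W → ι) (hH : GraphGrabbing.IsBlowUp T H part)
    (G : SimpleGraph V) (hub : W → V) (base : V → W) (hG : GraphGrabbing.IsHTree H G hub base)
    (hconn : G.Connected) (heven : Even (Fintype.card V)) (w : V → ℝ≥0) :
    (∀ v : V,
      GraphGrabbing.R G w {v} .one ≥ GraphGrabbing.N G w .two ∧
      GraphGrabbing.R G w {v} .two ≤ GraphGrabbing.N G w .one) ∧
    (∀ i : ι,
      GraphGrabbing.R G w (hub '' (part ⁻¹' {i})) .one ≥ GraphGrabbing.N G w .two ∧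
      GraphGrabbing.R G w (hub '' (part ⁻¹' {i})) .two ≤ GraphGrabbing.N G w .one) ∧
    (∀ i : ι, (GraphGrabbing.nbhd H (part ⁻¹' {i})).Nonempty →
      GraphGrabbing.R G w (hub '' GraphGrabbing.nbhd H (part ⁻¹' {i})) .one
        ≥ GraphGrabbing.N G w .two ∧
      GraphGrabbing.R G w (hub '' GraphGrabbing.nbhd H (part ⁻¹' {i})) .two
        ≤ GraphGrabbing.N G w .one) := by
  have hF := hG.isRootFamily hT.isAcyclic hH
  exact ⟨fun v => hF.score_le hconn heven w (Or.inl ⟨v, rfl⟩) ⟨v, rfl⟩,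
    fun i => hF.score_le hconn heven w (Or.inr (Or.inl ⟨i, rfl⟩)) ((hH.nonempty i).image hub),
    fun i hi => hF.score_le hconn heven w (Or.inr (Or.inr ⟨i, rfl⟩)) (hi.image hub)⟩
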